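/- Let $k$ be a finite field, let $X$ be a $k$-smooth irreducible affine $k$-variety, let $x_1,\dots,x_n\in X$ be closed points, let $\mathcal O_{X,\{x_1,\dots,x_n\}}$ be the semi-local ring of these points on $X$, and put $U=\mathrm{Spec}(\mathcal O_{X,\{x_1,\dots,x_n\}})$. For a closed point $u\in U$ with residue field $k(u)$ and a $U$-scheme $V$ write $V_u=u\times_U V$; let $\mathbb A^1_u$ be the affine line over $k(u)$. Let $S'$ be an irreducible regular semi-local scheme with a morphism $p:S'\to U$ such that all closed points of $S'$ have finite residue fields and such that for every closed point $u\in U$ the scheme $S'_u$ is a semi-local Dedekind scheme (a noetherian normal scheme of dimension at most one, not necessarily connected, with finitely many closed points). Let $i:T'\hookrightarrow S'$ be a closed subscheme such that $p|_{T'}:T'\to U$ is an isomorphism, and suppose that $\dim T'<\dim S'$ (Krull dimensions). Then there exist a finite étale morphism $\rho:S''\to S'$ with $S''$ irreducible and a section $\delta':T'\to S''$ of $\rho$ over $T'$ (that is, $\rho\circ\delta'=i$) such that for every closed point $u\in U$: (1) if $u'\in T'$ is the unique point with $p(u')=u$, then $\delta'(u')\in S''_u$ is the only $k(u)$-rational point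 of $S''_u$ (in particular it is $k(u)$-rational); (2) for every integer $d\ge 1$, $$\sharp\{z\in S''_u \mid [k(z):k(u)]=d\}\ \le\ \sharp\{x\in\mathbb A^1_u \mid [k(x):k(u)]=d\}.$$ -/

import Mathlib

open CategoryTheory AlgebraicGeometry

universe u

/-- The functions on `X` that do not vanish at any of the points `x i`. -/
def nonvanishingSubmonoid (X : Scheme.{u}) {n : ℕ} (x : Fin n → X) : Submonoid Γ(X, ⊤) where
  carrier := {a | ∀ i, x i ∈ X.basicOpen a}
  one_mem' := fun i => by simp [Scheme.basicOpen_one]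
  mul_mem' := fun {a b} ha hb i => by
    rw [Scheme.basicOpen_mul]
    exact ⟨ha i, hb i⟩

/-- The spectrum of the semi-local ring `𝒪_{X,{x₁,…,xₙ}}` of finitely many points of an affine
scheme `X`: the localization of `Γ(X, 𝒪_X)` at the functions that vanish at none of the `xᵢ`. -/
noncomputable def semilocalSpec (X : Scheme.{u}) {n : ℕ} (x : Fin n → X) : Scheme.{u} :=
  Spec (CommRingCat.of (Localization (nonvanishingSubmonoid X x)))

/-- A semi-local scheme: the spectrum of a ring with finitely many maximal ideals. -/
structure IsSemilocalScheme (X : Scheme.{u}) : Prop where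
  isAffine : IsAffine X
  finite_closedPoints : {x : X | IsClosed ({x} : Set X)}.Finite

/-- A regular scheme: locally noetherian with regular local rings. -/
structure IsRegularScheme (X : Scheme.{u}) : Prop where
  isLocallyNoetherian : IsLocallyNoetherian X
  isRegularLocalRing_stalk : ∀ x : X, IsRegularLocalRing (X.presheaf.stalk x)

/-- A Dedekind scheme: a noetherian normal scheme of dimension at most one. Such a scheme is
a finite disjoint union of irreducible ones; it is not required to be connected. -/
structure IsDedekindScheme (X : Scheme.{u}) : Prop where
  isNoetherian : IsNoetherian X
  isDomain_stalk : ∀ x : X, IsDomain (X.presheaf.stalk x)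
  isIntegrallyClosed_stalk : ∀ x : X, IsIntegrallyClosed (X.presheaf.stalk x)
  dim_le_one : topologicalKrullDim X ≤ 1

/-- The point `w` of a scheme `W` over the spectrum of a field `K` (via `g`) is `K`-rational if
the homomorphism `K → κ(w)` is bijective; `K` enters as the residue field at the only point
of `Spec K`. -/
def IsRationalPoint {K : CommRingCat.{u}} {W : Scheme.{u}} (g : W ⟶ Spec K) (w : W) : Prop :=
  Function.Bijective (g.residueFieldMap w)

/-- The number (possibly infinite) of points `w` of a scheme `W` over the spectrum of a field `K`
(via `g`) with `[κ(w) : K] = d`. It is used for `d ≥ 1` only: the degree of an infinite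
extension is `0` by convention. -/
noncomputable def numPointsOfDegree {K : CommRingCat.{u}} {W : Scheme.{u}} (g : W ⟶ Spec K)
    (d : ℕ) : ℕ∞ :=
  {w : W | g.residueDegree w = d}.encard

/-! Write S' = Spec B with B a regular semi-local domain, T' = V(I), and let M bound the number of
closed points of S'. Points of finite degree in a fibre over a closed point u lie over closed points
of S', because k(u) is finite. So it suffices to find a finite étale cover, with a lift of T', that
has over each closed point s of S' at most one point of each degree, where all these degrees are at
least some large D except for degree 1 at the points of the lift. Degrees multiply along z ↦ s ↦ u.
Hence the lifted point is the only rational point of the fibre, no degree strictly between 1 and D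
occurs, and each degree d ≥ D occurs at most M times. Over a finite field there are at least M monic
irreducible polynomials of each degree d ≥ D, and these give points of the affine line.

If T' contains all closed points of S', the identity cover works. Otherwise take S'' = Spec B[X]/(F)
with F monic of degree D + 1 and F(0) ∈ I, reducing to X·G with G irreducible of degree D at closed
points of T', and to an irreducible polynomial at the others (`exists_monic_separable_of_semilocal`,
by the Chinese remainder theorem). The lift of T' is X = 0. Finite fields are perfect, so F is
separable and the cover étale. Irreducibility comes from a closed point m₀ off T': there F stays
irreducible, so the localization of B[X]/(F) over m₀ is a regular local ring, hence a domain, and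
B[X]/(F) embeds in it. -/

/-! ### Regular local rings -/

open IsLocalRing in
/-- A minimal generator of the maximal ideal can be removed modulo itself. -/
theorem IsLocalRing.spanFinrank_maximalIdeal_quotient_lt {R : Type*} [CommRing R] [IsLocalRing R]
    [IsNoetherianRing R] {x : R} (hx : x ∈ maximalIdeal R) (hx2 : x ∉ maximalIdeal R ^ 2)
    [IsLocalRing (R ⧸ Ideal.span {x})] :
    (maximalIdeal (R ⧸ Ideal.span {x})).spanFinrank + 1 ≤ (maximalIdeal R).spanFinrank := by
  classical
  let v : CotangentSpace R := (maximalIdeal R).toCotangent ⟨x, hx⟩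
  have hv : v ≠ 0 := by
    intro h
    exact hx2 ((Ideal.toCotangent_eq_zero _ _).mp h)
  have hli : LinearIndepOn (ResidueField R) id ({v} : Set (CotangentSpace R)) := by
    exact (linearIndepOn_singleton_iff (ResidueField R)).mpr hv
  -- The class of `x` is completed to a basis of the cotangent space. By Nakayama, lifts of the
  -- basis generate the maximal ideal, and the generator `x` dies in the quotient.
  let b := Module.Basis.extend hli
  have hvb : v ∈ hli.extend (Set.subset_univ _) := hli.subset_extend _ rfl
  have hcard : (hli.extend (Set.subset_univ _)).ncard = (maximalIdeal R).spanFinrank := by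
    rw [spanFinrank_maximalIdeal_eq_finrank_cotangentSpace, Module.finrank_eq_nat_card_basis b]
    rfl
  have hfin : (hli.extend (Set.subset_univ _)).Finite := by
    have := Module.Finite.finite_basis b
    exact Set.toFinite _
  choose g hg using (maximalIdeal R).toCotangent_surjective
  let t : Set (maximalIdeal R) := g '' (hli.extend (Set.subset_univ _) \ {v})
  have htfin : t.Finite := (hfin.subset Set.sdiff_subset).image _
  have htcard : t.ncard + 1 ≤ (maximalIdeal R).spanFinrank := by
    have h1 : t.ncard ≤ _ := Set.ncard_image_le (hfin.subset Set.sdiff_subset)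
    have h2 := Set.ncard_sdiff_singleton_add_one hvb hfin
    omega
  have hspan : Submodule.span R (insert ⟨x, hx⟩ t) = ⊤ := by
    rw [← CotangentSpace.span_image_eq_top_iff, eq_top_iff, ← b.span_eq, Submodule.span_le]
    rintro _ ⟨⟨w, hw⟩, rfl⟩
    apply Submodule.subset_span
    have hbw : b ⟨w, hw⟩ = w := by simp [b]
    rw [hbw]
    by_cases hwv : w = v
    · exact ⟨_, Set.mem_insert _ _, hwv.symm⟩
    · exact ⟨g w, Set.mem_insert_of_mem _ ⟨w, ⟨hw, hwv⟩, rfl⟩, hg w⟩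
  have hspan' : Ideal.span (insert x ((↑) '' t : Set R)) = maximalIdeal R := by
    have := congrArg (Submodule.map (maximalIdeal R).subtype) hspan
    rw [Submodule.map_span, Submodule.map_top, Submodule.range_subtype, Set.image_insert_eq] at this
    exact this
  have hmax : Ideal.span ((Ideal.Quotient.mk (Ideal.span {x})) '' ((↑) '' t : Set R)) =
      maximalIdeal (R ⧸ Ideal.span {x}) := by
    have hloc : IsLocalHom (Ideal.Quotient.mk (Ideal.span {x})) :=
      .of_surjective _ Ideal.Quotient.mk_surjective
    have h1 : (maximalIdeal R).map (Ideal.Quotient.mk (Ideal.span {x})) =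
        maximalIdeal (R ⧸ Ideal.span {x}) := by
      refine le_antisymm ?_ fun y hy => ?_
      · exact (local_hom_TFAE (Ideal.Quotient.mk (Ideal.span {x}))).out 0 2 |>.mp hloc
      · obtain ⟨y, rfl⟩ := Ideal.Quotient.mk_surjective y
        refine Ideal.mem_map_of_mem _ ?_
        rw [mem_maximalIdeal, mem_nonunits_iff] at hy ⊢
        exact fun h => hy (h.map _)
    have h2 := congrArg (Ideal.map (Ideal.Quotient.mk (Ideal.span {x}))) hspan'
    rw [h1, Ideal.map_span, Set.image_insert_eq] at h2
    rw [← h2]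
    have : (Ideal.Quotient.mk (Ideal.span {x})) x = 0 :=
      Ideal.Quotient.eq_zero_iff_mem.mpr (Ideal.mem_span_singleton_self x)
    rw [this, Ideal.span_insert_zero]
  have h3 := Submodule.spanFinrank_span_le_ncard_of_finite (R := R ⧸ Ideal.span {x})
    ((htfin.image (Subtype.val)).image (Ideal.Quotient.mk (Ideal.span {x})))
  have h4 := Set.ncard_image_le (f := Ideal.Quotient.mk (Ideal.span {x}))
    (htfin.image (Subtype.val))
  have h5 := Set.ncard_image_le (f := (Subtype.val : maximalIdeal R → R)) htfin
  rw [← hmax]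
  change (Submodule.span _ _).spanFinrank + 1 ≤ _
  omega

open IsLocalRing in
/-- Regular local rings are domains. -/
theorem IsRegularLocalRing.isDomain (R : Type*) [CommRing R] [h : IsRegularLocalRing R] :
    IsDomain R := by
  obtain ⟨n, hn⟩ : ∃ n, (maximalIdeal R).spanFinrank = n := ⟨_, rfl⟩
  induction n generalizing R with
  | zero =>
    have h0 : maximalIdeal R = ⊥ :=
      (Submodule.spanFinrank_eq_zero_iff_eq_bot (maximalIdeal R).fg_of_isNoetherianRing).mp hn
    exact ((IsLocalRing.isField_iff_maximalIdeal_eq).mpr h0).isDomain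
  | succ n ih =>
    have hdim := h.spanFinrank_maximalIdeal
    have hne : maximalIdeal R ≠ ⊥ := by
      intro h0
      rw [h0, Submodule.spanFinrank_bot] at hn
      omega
    obtain ⟨x, hxm, hx2, hxp⟩ : ∃ x ∈ maximalIdeal R, x ∉ maximalIdeal R ^ 2 ∧
        ∀ p ∈ minimalPrimes R, x ∉ p := by
      -- Prime avoidance, which tolerates the non-prime ideal m². If m ⊆ m², Nakayama gives m = 0;
      -- if m lies in a minimal prime, the dimension is 0. Both are excluded.
      by_contra! hcon
      have hfin : (insert (maximalIdeal R ^ 2) (minimalPrimes R)).Finite :=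
        (minimalPrimes.finite_of_isNoetherianRing R).insert _
      have := (Ideal.subset_union_prime_finite hfin (f := id) (maximalIdeal R ^ 2)
        (maximalIdeal R ^ 2) (I := maximalIdeal R) (by
          rintro p (rfl | hp) h1 -
          · exact absurd rfl h1
          · exact hp.1.1)).mp (by
          intro x hx
          by_cases hx2 : x ∈ maximalIdeal R ^ 2
          · exact Set.mem_biUnion (Set.mem_insert _ _) hx2
          · obtain ⟨p, hp, hxp⟩ := hcon x hx hx2
            exact Set.mem_biUnion (Set.mem_insert_of_mem _ hp) hxp)
      obtain ⟨p, hp, hle⟩ := this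
      rcases hp with rfl | hp
      · apply hne
        apply Submodule.eq_bot_of_le_smul_of_le_jacobson_bot (maximalIdeal R) (maximalIdeal R)
          (maximalIdeal R).fg_of_isNoetherianRing
        · rw [smul_eq_mul, ← sq]; exact hle
        · exact IsLocalRing.maximalIdeal_le_jacobson _
      · have hpp : p.IsPrime := hp.1.1
        have hpm : p = maximalIdeal R := (IsLocalRing.le_maximalIdeal hpp.ne_top).antisymm hle
        have hh : (maximalIdeal R).height = 0 := by
          rw [← hpm, Ideal.height_eq_zero_iff]
          exact hp
        have := IsLocalRing.maximalIdeal_height_eq_ringKrullDim (R := R)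
        rw [hh, ← hdim, hn] at this
        norm_cast at this
    have hnt : Nontrivial (R ⧸ Ideal.span {x}) :=
      Ideal.Quotient.nontrivial_iff.mpr (by
        rw [Ne, Ideal.span_singleton_eq_top]; exact hxm)
    have hloc : IsLocalRing (R ⧸ Ideal.span {x}) :=
      .of_surjective' _ Ideal.Quotient.mk_surjective
    have hlt := IsLocalRing.spanFinrank_maximalIdeal_quotient_lt hxm hx2
    have hle : ringKrullDim R ≤ ringKrullDim (R ⧸ Ideal.span {x}) + 1 := by
      rw [← IsLocalRing.maximalIdeal_height_eq_ringKrullDim (R := R)]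
      exact Ideal.height_le_ringKrullDim_quotient_add_one hxm
    have hge := ringKrullDim_le_spanFinrank_maximalIdeal (R := R ⧸ Ideal.span {x})
    -- Modulo `x` the dimension drops by at most one and the number of generators of m by at least
    -- one.
    have hreg : IsRegularLocalRing (R ⧸ Ideal.span {x}) := by
      apply IsRegularLocalRing.of_spanFinrank_maximalIdeal_le
      rw [← hdim] at hle
      have h1 : (((maximalIdeal (R ⧸ Ideal.span {x})).spanFinrank + 1 : ℕ) : WithBot ℕ∞) ≤
          ringKrullDim (R ⧸ Ideal.span {x}) + 1 := le_trans (by exact_mod_cast hlt) hle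
      push_cast at h1
      exact ENat.WithBot.add_le_add_one_right_iff.mp h1
    have heq : (maximalIdeal (R ⧸ Ideal.span {x})).spanFinrank = n := by
      have h1 := hreg.spanFinrank_maximalIdeal
      rw [← hdim, ← h1, hn] at hle
      have : n + 1 ≤ (maximalIdeal (R ⧸ Ideal.span {x})).spanFinrank + 1 := by
        exact_mod_cast hle
      omega
    have hdom := ih (R ⧸ Ideal.span {x}) heq
    have hprime : (Ideal.span {x}).IsPrime := Ideal.Quotient.isDomain_iff_prime _ |>.mp hdom
    obtain ⟨p, hp, hpx⟩ := Ideal.exists_minimalPrimes_le (bot_le : ⊥ ≤ Ideal.span {x})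
    have hpp : p.IsPrime := hp.1.1
    have hxp' : x ∉ p := hxp p hp
    -- Since p ⊆ (x) and x ∉ p, every element of p is x times an element of p; so p ⊆ m·p, and
    -- Nakayama applies.
    have hp0 : p = ⊥ := by
      apply Submodule.eq_bot_of_le_smul_of_le_jacobson_bot (maximalIdeal R) p
        p.fg_of_isNoetherianRing
      · intro y hy
        obtain ⟨a, rfl⟩ := Ideal.mem_span_singleton'.mp (hpx hy)
        have ha : a ∈ p := (hpp.mem_or_mem hy).resolve_right hxp'
        rw [smul_eq_mul, mul_comm a]
        exact Ideal.mul_mem_mul hxm ha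
      · exact IsLocalRing.maximalIdeal_le_jacobson _
    subst hp0
    exact IsDomain.of_bot_isPrime R

/-! ### Adjoining a root: domains, separability, étaleness -/

open IsLocalRing Polynomial in
/-- Over a regular local ring, adjoining a root of a monic polynomial with irreducible reduction
gives a domain. -/
theorem AdjoinRoot.isDomain_of_irreducible_map_residue {R : Type*} [CommRing R]
    [hR : IsRegularLocalRing R] {F : R[X]} (hF : F.Monic)
    (hirr : Irreducible (F.map (residue R))) : IsDomain (AdjoinRoot F) := by
  have : Fact (Irreducible (F.map (residue R))) := ⟨hirr⟩
  let φ : R[X] →+* AdjoinRoot (F.map (residue R)) :=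
    (AdjoinRoot.mk _).comp (mapRingHom (residue R))
  have hφ : Function.Surjective φ :=
    AdjoinRoot.mk_surjective.comp (map_surjective _ residue_surjective)
  let P : Ideal R[X] := RingHom.ker φ
  have hP : P.IsMaximal := RingHom.ker_isMaximal_of_surjective φ hφ
  have hFP : F ∈ P := by simp [P, φ, RingHom.mem_ker]
  have hPeq : P = (maximalIdeal R).map C ⊔ Ideal.span {F} := by
    apply le_antisymm
    · intro h hh
      have : F.map (residue R) ∣ h.map (residue R) := by
        rwa [← AdjoinRoot.mk_eq_zero]
      obtain ⟨g, hg⟩ := this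
      obtain ⟨g, rfl⟩ := map_surjective _ residue_surjective g
      have h1 : h - F * g ∈ (maximalIdeal R).map C := by
        have : h - F * g ∈ RingHom.ker (mapRingHom (residue R)) := by
          simp [RingHom.mem_ker, hg]
        rwa [ker_mapRingHom, ker_residue] at this
      rw [← sub_add_cancel h (F * g)]
      exact Submodule.add_mem_sup h1 (Ideal.mul_mem_right _ _ (Ideal.mem_span_singleton_self F))
    · rw [sup_le_iff, Ideal.map_le_iff_le_comap, Ideal.span_singleton_le_iff_mem]
      refine ⟨fun a ha => ?_, hFP⟩
      have : residue R a = 0 := (residue_eq_zero_iff a).mpr ha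
      simp [P, φ, RingHom.mem_ker, this]
  have hfin : Module.Finite R (AdjoinRoot F) := hF.finite_adjoinRoot
  -- By integrality every maximal ideal of R[X]/(F) lies over m, so its preimage in R[X] contains m
  -- and F, hence equals P = (m, F).
  have huniq : ∀ Q : Ideal (AdjoinRoot F), Q.IsMaximal → Q = P.map (AdjoinRoot.mk F) := by
    intro Q hQ
    have h1 : (Q.comap (algebraMap R (AdjoinRoot F))).IsMaximal :=
      Ideal.isMaximal_comap_of_isIntegral_of_isMaximal Q
    have h2 := IsLocalRing.eq_maximalIdeal h1
    have h3 : P ≤ Q.comap (AdjoinRoot.mk F) := by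
      rw [hPeq, sup_le_iff, Ideal.map_le_iff_le_comap, Ideal.span_singleton_le_iff_mem]
      refine ⟨fun a ha => ?_, ?_⟩
      · rw [← h2] at ha
        exact ha
      · simp [Ideal.mem_comap]
    have h4 : P = Q.comap (AdjoinRoot.mk F) := by
      apply hP.eq_of_le _ h3
      exact Ideal.comap_ne_top _ hQ.ne_top
    rw [h4, Ideal.map_comap_of_surjective _ AdjoinRoot.mk_surjective]
  have hnt : Nontrivial (AdjoinRoot F) := by
    have : Nontrivial (R[X] ⧸ Ideal.span {F}) :=
      Ideal.Quotient.nontrivial_iff.mpr fun h =>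
        hP.ne_top (top_le_iff.mp (h ▸ (Ideal.span_singleton_le_iff_mem _).mpr hFP))
    exact this
  have hloc : IsLocalRing (AdjoinRoot F) := by
    obtain ⟨Q, hQ⟩ := Ideal.exists_maximal (AdjoinRoot F)
    refine .of_unique_max_ideal ⟨Q, hQ, fun Q' hQ' => ?_⟩
    rw [huniq Q hQ, huniq Q' hQ']
  have hnoeth : IsNoetherianRing (AdjoinRoot F) := IsNoetherianRing.of_finite R _
  have hmax : maximalIdeal (AdjoinRoot F) = (maximalIdeal R).map (algebraMap R (AdjoinRoot F)) := by
    rw [huniq _ (maximalIdeal.isMaximal _), hPeq, Ideal.map_sup, Ideal.map_map, Ideal.map_span,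
      Set.image_singleton, AdjoinRoot.mk_self, Ideal.span_singleton_zero, sup_bot_eq]
    rfl
  -- The maximal ideal is extended from R, so dim R generators suffice. The dimension is at least
  -- dim R: P strictly contains mR[X], which has the height of m and misses the monic F, and killing
  -- F costs at most one.
  have hreg : IsRegularLocalRing (AdjoinRoot F) := by
    apply IsRegularLocalRing.of_spanFinrank_maximalIdeal_le
    have h1 : (maximalIdeal (AdjoinRoot F)).spanFinrank ≤ (maximalIdeal R).spanFinrank := by
      rw [hmax]
      exact Ideal.spanFinrank_map_le_of_fg _ (maximalIdeal R).fg_of_isNoetherianRing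
    have hmp : ((maximalIdeal R).map C : Ideal R[X]).IsPrime := Ideal.isPrime_map_C_of_isPrime
    have hlt : (maximalIdeal R).map C < P := by
      refine lt_of_le_of_ne (hPeq ▸ le_sup_left) fun h => ?_
      rw [← h, Ideal.mem_map_C_iff] at hFP
      have := hFP F.natDegree
      rw [hF.coeff_natDegree] at this
      exact (Ideal.ne_top_iff_one _).mp (maximalIdeal.isMaximal R).ne_top this
    have h2 := Ideal.height_add_one_le_of_lt_of_isPrime hlt
    have h3 : (P.height : WithBot ℕ∞) ≤ ringKrullDim (AdjoinRoot F) + 1 :=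
      Ideal.height_le_ringKrullDim_quotient_add_one hFP
    rw [Polynomial.height_map_C] at h2
    have h4 : ringKrullDim R + 1 ≤ ringKrullDim (AdjoinRoot F) + 1 := by
      rw [← IsLocalRing.maximalIdeal_height_eq_ringKrullDim (R := R)]
      exact le_trans (by exact_mod_cast h2) h3
    have h5 := ENat.WithBot.add_le_add_one_right_iff.mp h4
    rw [← hR.spanFinrank_maximalIdeal] at h5
    exact le_trans (by exact_mod_cast h1) h5
  exact hreg.isDomain

open Polynomial in
/-- Adjoining to a domain `B` a root of a monic polynomial that is irreducible at a regular closed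
point gives a domain. -/
theorem AdjoinRoot.isDomain_of_irreducible_map_quotient {B : Type*} [CommRing B] [IsDomain B]
    (m : Ideal B) [hm : m.IsMaximal] [IsRegularLocalRing (Localization.AtPrime m)] {F : B[X]}
    (hF : F.Monic) (hirr : Irreducible (F.map (Ideal.Quotient.mk m))) :
    IsDomain (AdjoinRoot F) := by
  let R := Localization.AtPrime m
  have hinj : Function.Injective (algebraMap B R) :=
    IsLocalization.injective R m.primeCompl_le_nonZeroDivisors
  have hirr' : Irreducible ((F.map (algebraMap B R)).map (IsLocalRing.residue R)) := by
    let e := IsLocalization.AtPrime.equivQuotMaximalIdeal m R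
    have h1 : (F.map (algebraMap B R)).map (IsLocalRing.residue R) =
        mapEquiv e (F.map (Ideal.Quotient.mk m)) := by
      rw [mapEquiv_apply, map_map, map_map]
      congr 1
    rw [h1]
    exact (MulEquiv.irreducible_iff (mapEquiv e)).mpr hirr
  have := AdjoinRoot.isDomain_of_irreducible_map_residue (hF.map (algebraMap B R)) hirr'
  let φ : AdjoinRoot F →+* AdjoinRoot (F.map (algebraMap B R)) :=
    AdjoinRoot.lift ((AdjoinRoot.of _).comp (algebraMap B R)) (AdjoinRoot.root _) (by
      rw [← eval₂_map, AdjoinRoot.eval₂_root])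
  -- Division by a monic polynomial is compatible with the injection of B into its localization.
  have hφ : Function.Injective φ := by
    rw [injective_iff_map_eq_zero]
    intro y hy
    obtain ⟨h, rfl⟩ := AdjoinRoot.mk_surjective y
    have h1 : φ (AdjoinRoot.mk F h) = AdjoinRoot.mk _ (h.map (algebraMap B R)) := by
      rw [AdjoinRoot.lift_mk, ← eval₂_map, ← AdjoinRoot.algebraMap_eq, ← aeval_def,
        AdjoinRoot.aeval_eq]
    rw [h1, AdjoinRoot.mk_eq_zero, map_dvd_map _ hinj hF] at hy
    rwa [AdjoinRoot.mk_eq_zero]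
  exact hφ.isDomain φ

open Polynomial in
/-- A monic polynomial is separable if its reductions at all maximal ideals are. -/
theorem Polynomial.Monic.separable_of_forall_maximal {B : Type*} [CommRing B] {F : B[X]}
    (hF : F.Monic) (h : ∀ m : Ideal B, m.IsMaximal → (F.map (Ideal.Quotient.mk m)).Separable) :
    F.Separable := by
  rw [separable_def, ← Ideal.isCoprime_span_singleton_iff, Ideal.isCoprime_iff_sup_eq]
  by_contra hne
  obtain ⟨M, hM, hle⟩ := Ideal.exists_le_maximal _ hne
  rw [sup_le_iff, Ideal.span_singleton_le_iff_mem, Ideal.span_singleton_le_iff_mem] at hle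
  -- A maximal ideal M containing F and F' has B[X]/M finite over B, so M ∩ B is maximal. The Bézout
  -- relation modulo M ∩ B then puts 1 in M.
  let ψ : AdjoinRoot F →+* B[X] ⧸ M := AdjoinRoot.lift ((Ideal.Quotient.mk M).comp C)
    (Ideal.Quotient.mk M X) (by
      rw [← hom_eval₂, eval₂_C_X]
      exact Ideal.Quotient.eq_zero_iff_mem.mpr hle.1)
  have hψ : ψ.comp (AdjoinRoot.mk F) = Ideal.Quotient.mk M := by
    ext <;> simp [ψ]
  have hψs : Function.Surjective ψ := by
    have : Function.Surjective (ψ.comp (AdjoinRoot.mk F)) := hψ ▸ Ideal.Quotient.mk_surjective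
    exact Function.Surjective.of_comp (g := AdjoinRoot.mk F) this
  have := hF.finite_adjoinRoot
  have hK : (RingHom.ker ψ).IsMaximal := by
    let := Ideal.Quotient.field M
    exact RingHom.ker_isMaximal_of_surjective ψ hψs
  have hm := Ideal.isMaximal_comap_of_isIntegral_of_isMaximal (R := B) (RingHom.ker ψ)
  obtain ⟨a, b, hab⟩ := h _ hm
  obtain ⟨a, rfl⟩ := map_surjective _ Ideal.Quotient.mk_surjective a
  obtain ⟨b, rfl⟩ := map_surjective _ Ideal.Quotient.mk_surjective b
  rw [derivative_map, ← Polynomial.map_mul, ← Polynomial.map_mul, ← Polynomial.map_add,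
    ← sub_eq_zero, ← Polynomial.map_one (Ideal.Quotient.mk _), ← Polynomial.map_sub] at hab
  have h1 : (a * F + b * derivative F - 1) ∈ M := by
    have h2 : (a * F + b * derivative F - 1) ∈
        Ideal.map C ((RingHom.ker ψ).comap (algebraMap B (AdjoinRoot F))) := by
      rw [← coe_mapRingHom, ← RingHom.mem_ker, ker_mapRingHom, Ideal.mk_ker] at hab
      exact hab
    refine Ideal.map_le_iff_le_comap.mpr ?_ h2
    intro c hc
    have h3 : ψ (AdjoinRoot.mk F (C c)) = 0 := hc
    rw [← RingHom.comp_apply, hψ] at h3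
    exact Ideal.mem_comap.mpr (Ideal.Quotient.eq_zero_iff_mem.mp h3)
  apply hM.ne_top
  rw [Ideal.eq_top_iff_one]
  have h2 := M.sub_mem (M.add_mem (M.mul_mem_left a hle.1) (M.mul_mem_left b hle.2)) h1
  simpa using h2

open Polynomial in
/-- Adjoining a root of a monic separable polynomial is étale. -/
theorem AdjoinRoot.etale_of_separable {B : Type*} [CommRing B] {F : B[X]}
    (hF : F.Monic) (h : F.Separable) : Algebra.Etale B (AdjoinRoot F) := by
  obtain ⟨a, b, hab⟩ := h
  -- The standard étale algebra in which only 1 is inverted; the Bézout relation says that F' is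
  -- already a unit modulo F.
  let P : StandardEtalePair B := ⟨F, hF, 1, b, a, 0, by rw [pow_zero, ← hab]; ring⟩
  have e : P.Ring ≃ₐ[B] AdjoinRoot F := P.equivAwayAdjoinRoot.trans <| by
    have : AdjoinRoot.mk P.f P.g = 1 := map_one _
    rw [this]
    exact ((IsLocalization.atOne (AdjoinRoot F)
      (Localization.Away (1 : AdjoinRoot F))).restrictScalars B).symm
  exact Algebra.Etale.of_equiv e

/-! ### Prescribed reductions over a semi-local ring -/

/-- The Chinese remainder theorem for a semi-local ring, inside an ideal. -/
theorem exists_mem_forall_quotient_mk_eq {B : Type*} [CommRing B] [Finite (MaximalSpectrum B)]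
    (I : Ideal B) (c : ∀ m : MaximalSpectrum B, B ⧸ m.asIdeal)
    (hc : ∀ m : MaximalSpectrum B, I ≤ m.asIdeal → c m = 0) :
    ∃ b ∈ I, ∀ m : MaximalSpectrum B, Ideal.Quotient.mk m.asIdeal b = c m := by
  classical
  have := Fintype.ofFinite (MaximalSpectrum B)
  have hcop : Pairwise fun m m' : MaximalSpectrum B => IsCoprime m.asIdeal m'.asIdeal := by
    intro m m' hne
    rw [Ideal.isCoprime_iff_sup_eq]
    exact m.isMaximal.coprime_of_ne m'.isMaximal fun h => hne (MaximalSpectrum.ext h)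
  obtain ⟨b, hb⟩ := Ideal.quotientInfToPiQuotient_surj hcop c
  obtain ⟨b, rfl⟩ := Ideal.Quotient.mk_surjective b
  -- I is coprime to the intersection of the maximal ideals not containing it. This gives e ∈ I
  -- congruent to 1 modulo each of them, and e·b corrects b into I.
  have htop : I ⊔ ⨅ m ∈ Finset.univ.filter (fun m : MaximalSpectrum B => ¬ I ≤ m.asIdeal),
      m.asIdeal = ⊤ := by
    apply Ideal.sup_iInf_eq_top
    intro m hm
    rw [sup_comm]
    have hm : ¬ I ≤ m.asIdeal := (Finset.mem_filter.mp hm).2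
    apply m.isMaximal.1.2
    exact left_lt_sup.mpr hm
  obtain ⟨e, he, j, hj, hej⟩ := Submodule.mem_sup.mp ((Ideal.eq_top_iff_one _).mp htop)
  refine ⟨e * b, I.mul_mem_right b he, fun m => ?_⟩
  by_cases hm : I ≤ m.asIdeal
  · rw [hc m hm, Ideal.Quotient.eq_zero_iff_mem]
    exact Ideal.mul_mem_right _ _ (hm he)
  · have hjm : Ideal.Quotient.mk m.asIdeal j = 0 := by
      rw [Ideal.Quotient.eq_zero_iff_mem]
      simp only [Submodule.mem_iInf] at hj
      exact hj m (by simp [hm])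
    have h1 := congrArg (Ideal.Quotient.mk m.asIdeal) hej
    rw [map_add, hjm, add_zero, map_one] at h1
    rw [map_mul, h1, one_mul]
    exact congrFun hb m

open Polynomial in
/-- A monic polynomial over a semi-local ring with prescribed reductions. -/
theorem exists_monic_forall_map_quotient_mk_eq {B : Type*} [CommRing B] [Nontrivial B]
    [Finite (MaximalSpectrum B)]
    (I : Ideal B) {N : ℕ} (hN : N ≠ 0) (f : ∀ m : MaximalSpectrum B, (B ⧸ m.asIdeal)[X])
    (hf : ∀ m, (f m).Monic) (hfN : ∀ m, (f m).natDegree = N)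
    (hfI : ∀ m : MaximalSpectrum B, I ≤ m.asIdeal → (f m).coeff 0 = 0) :
    ∃ F : B[X], F.Monic ∧ F.coeff 0 ∈ I ∧
      ∀ m : MaximalSpectrum B, F.map (Ideal.Quotient.mk m.asIdeal) = f m := by
  have h : ∀ i : ℕ, ∃ b : B, (i = 0 → b ∈ I) ∧
      ∀ m : MaximalSpectrum B, Ideal.Quotient.mk m.asIdeal b = (f m).coeff i := by
    intro i
    by_cases hi : i = 0
    · subst hi
      obtain ⟨b, hb, h⟩ := exists_mem_forall_quotient_mk_eq I (fun m => (f m).coeff 0) hfI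
      exact ⟨b, fun _ => hb, h⟩
    · obtain ⟨b, hb, h⟩ := exists_mem_forall_quotient_mk_eq ⊤ (fun m => (f m).coeff i)
        (fun m hm => absurd (top_le_iff.mp hm) m.isMaximal.ne_top)
      exact ⟨b, fun h => absurd h hi, h⟩
  choose b hb0 hb using h
  have hdeg : (∑ i : Fin N, C (b i) * X ^ (i : ℕ)).degree < (N : WithBot ℕ) := degree_sum_fin_lt _
  refine ⟨X ^ N + ∑ i : Fin N, C (b i) * X ^ (i : ℕ), monic_X_pow_add hdeg, ?_, fun m => ?_⟩
  · have : (∑ i : Fin N, C (b i) * X ^ (i : ℕ)).coeff 0 = b 0 := by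
      rw [finsetSum_coeff, Finset.sum_eq_single ⟨0, Nat.pos_of_ne_zero hN⟩]
      · simp
      · intro i _ hi
        rw [coeff_C_mul, coeff_X_pow, if_neg, mul_zero]
        exact fun h => hi (Fin.ext h.symm)
      · simp
    rw [coeff_add, coeff_X_pow, if_neg hN.symm, zero_add, this]
    exact hb0 0 rfl
  · conv_rhs => rw [(hf m).as_sum, hfN]
    rw [Polynomial.map_add, Polynomial.map_pow, map_X, Polynomial.map_sum, Finset.sum_range]
    simp [hb]

/-! ### Counting irreducible polynomials over finite fields -/

open Polynomial in
/-- A lower bound for the number of monic irreducible polynomials of degree `d` over a finite field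
that has an extension of degree `d`. -/
theorem FiniteField.le_encard_monic_irreducible_of_finrank_eq {K L : Type*} [Field K] [Finite K]
    [Field L] [Algebra K L] [FiniteDimensional K L] {d M : ℕ} (hrank : Module.finrank K L = d)
    (hd : d ≠ 0) (h : (M + 1) * d ≤ 2 ^ (d / 2)) :
    (M : ℕ∞) ≤ {f : K[X] | f.Monic ∧ Irreducible f ∧ f.natDegree = d}.encard := by
  classical
  by_contra! hlt
  have hfin : {f : K[X] | f.Monic ∧ Irreducible f ∧ f.natDegree = d}.Finite :=
    Set.finite_of_encard_le_coe hlt.le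
  obtain ⟨s, hs⟩ := hfin.exists_finset_coe
  rw [← hs, Set.encard_coe_eq_coe_finsetCard, Nat.cast_lt] at hlt
  have : Finite L := Module.finite_of_finite K
  have := Fintype.ofFinite L
  have hcard : Fintype.card L = Nat.card K ^ d := by
    rw [Fintype.card_eq_nat_card, Module.natCard_eq_pow_finrank (K := K), hrank]
  have hq : 2 ≤ Nat.card K := Finite.one_lt_card
  -- The degree of an element of L divides d. If it is not d, it is some e ≤ d/2, and the element is
  -- a root of X^(q^e) − X, where q = #K.
  have hcover : (Finset.univ : Finset L) ⊆
      (s.biUnion fun f => (f.aroots L).toFinset) ∪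
        (Finset.Icc 1 (d / 2)).biUnion fun e =>
          ((X ^ Nat.card K ^ e - X : K[X]).aroots L).toFinset := by
    intro x _
    have hx : IsIntegral K x := Algebra.IsIntegral.isIntegral x
    have hirr := minpoly.irreducible hx
    rw [Finset.mem_union, Finset.mem_biUnion, Finset.mem_biUnion]
    have hdvd : (minpoly K x).natDegree ∣ d := hrank ▸ minpoly.degree_dvd hx
    by_cases hxd : (minpoly K x).natDegree = d
    · left
      refine ⟨minpoly K x, ?_, ?_⟩
      · rw [← Finset.mem_coe, hs]
        exact ⟨minpoly.monic hx, hirr, hxd⟩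
      · rw [Multiset.mem_toFinset, mem_aroots]
        exact ⟨minpoly.ne_zero hx, minpoly.aeval K x⟩
    · right
      refine ⟨(minpoly K x).natDegree, ?_, ?_⟩
      · rw [Finset.mem_Icc]
        refine ⟨hirr.natDegree_pos, ?_⟩
        obtain ⟨c, hc⟩ := hdvd
        have hc2 : 2 ≤ c := by
          rcases c with _ | _ | c
          · simp at hc; omega
          · simp at hc; omega
          · omega
        rw [Nat.le_div_iff_mul_le two_pos]
        calc _ ≤ (minpoly K x).natDegree * c := Nat.mul_le_mul_left _ hc2
          _ = d := hc.symm
      · rw [Multiset.mem_toFinset, mem_aroots]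
        refine ⟨FiniteField.X_pow_card_pow_sub_X_ne_zero _ hirr.natDegree_pos.ne' hq, ?_⟩
        obtain ⟨g, hg⟩ := hirr.natDegree_dvd_iff_dvd_X_pow_card_pow_sub_X.mp dvd_rfl
        rw [hg, map_mul, minpoly.aeval, zero_mul]
  have hle := Finset.card_le_card hcover
  rw [Finset.card_univ, hcard] at hle
  have h1 : (s.biUnion fun f => (f.aroots L).toFinset).card ≤ s.card * d := by
    apply Finset.card_biUnion_le_card_mul
    intro f hf
    have hf' : f ∈ {f : K[X] | f.Monic ∧ Irreducible f ∧ f.natDegree = d} := hs ▸ hf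
    calc _ ≤ (f.aroots L).card := Multiset.toFinset_card_le _
      _ ≤ (f.map (algebraMap K L)).natDegree := card_roots' _
      _ ≤ d := natDegree_map_le.trans hf'.2.2.le
  have h2 : ((Finset.Icc 1 (d / 2)).biUnion fun e =>
      ((X ^ Nat.card K ^ e - X : K[X]).aroots L).toFinset).card ≤
        (Finset.Icc 1 (d / 2)).card * Nat.card K ^ (d / 2) := by
    apply Finset.card_biUnion_le_card_mul
    intro e he
    rw [Finset.mem_Icc] at he
    calc _ ≤ ((X ^ Nat.card K ^ e - X : K[X]).aroots L).card := Multiset.toFinset_card_le _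
      _ ≤ ((X ^ Nat.card K ^ e - X : K[X]).map (algebraMap K L)).natDegree := card_roots' _
      _ ≤ (X ^ Nat.card K ^ e - X : K[X]).natDegree := natDegree_map_le
      _ = Nat.card K ^ e :=
        FiniteField.X_pow_card_pow_sub_X_natDegree_eq _ (by omega) hq
      _ ≤ _ := Nat.pow_le_pow_right (by omega) he.2
  rw [Nat.card_Icc, Nat.add_sub_cancel] at h2
  have h3 := hle.trans (Finset.card_union_le _ _)
  -- Of the M + 1 copies of d·q^(d/2), M dominate the roots of fewer than M polynomials of degree d,
  -- and the last strictly exceeds the bound (d/2)·q^(d/2) for elements of smaller degree.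
  have h4 : (M + 1) * d * Nat.card K ^ (d / 2) ≤ Nat.card K ^ d := by
    calc _ ≤ Nat.card K ^ (d - d / 2) * Nat.card K ^ (d / 2) := by
          gcongr
          calc _ ≤ 2 ^ (d / 2) := h
            _ ≤ Nat.card K ^ (d / 2) := Nat.pow_le_pow_left hq _
            _ ≤ _ := Nat.pow_le_pow_right (by omega) (by omega)
      _ = _ := by rw [← pow_add]; congr 1; omega
  have h5 : 0 < Nat.card K ^ (d / 2) := by positivity
  have h6 : s.card * d ≤ M * d * Nat.card K ^ (d / 2) :=
    (Nat.mul_le_mul_right d hlt.le).trans (Nat.le_mul_of_pos_right _ h5)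
  have h7 : d / 2 * Nat.card K ^ (d / 2) < d * Nat.card K ^ (d / 2) :=
    Nat.mul_lt_mul_of_pos_right (by omega) h5
  have h8 : (M + 1) * d * Nat.card K ^ (d / 2) =
    M * d * Nat.card K ^ (d / 2) + d * Nat.card K ^ (d / 2) := by ring
  omega

open Polynomial in
/-- A lower bound for the number of monic irreducible polynomials over a finite field. -/
theorem FiniteField.le_encard_monic_irreducible {K : Type*} [Field K] [Finite K] {d M : ℕ}
    (hd : d ≠ 0) (h : (M + 1) * d ≤ 2 ^ (d / 2)) :
    (M : ℕ∞) ≤ {f : K[X] | f.Monic ∧ Irreducible f ∧ f.natDegree = d}.encard := by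
  obtain ⟨p, hp⟩ := CharP.exists K
  have : Fact p.Prime := ⟨CharP.char_is_prime K p⟩
  have : NeZero d := ⟨hd⟩
  exact le_encard_monic_irreducible_of_finrank_eq (FiniteField.finrank_extension K p d) hd h

/-- Exponentials eventually dominate linear functions. -/
theorem exists_forall_mul_le_two_pow_half (M : ℕ) :
    ∃ D : ℕ, 2 ≤ D ∧ ∀ d, D ≤ d → M * d ≤ 2 ^ (d / 2) := by
  have key : ∀ n, n * n ≤ 2 ^ n * 2 := by
    intro n
    induction n with
    | zero => simp
    | succ n ih =>
      rcases Nat.lt_or_ge n 3 with h | h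
      · interval_cases n <;> norm_num
      · rw [pow_succ]; nlinarith
  -- With h = d/2 ≥ max(8M, 1) one gets M·d ≤ 3Mh ≤ h²/2 ≤ 2^h.
  refine ⟨16 * M + 2, by omega, fun d hd => ?_⟩
  have h1 := key (d / 2)
  have h2 : 8 * M ≤ d / 2 := by omega
  have h3 : d ≤ 2 * (d / 2) + 1 := by omega
  have h4 : 1 ≤ d / 2 := by omega
  nlinarith

/-! ### The polynomial defining the cover -/

open Polynomial in
/-- The monic irreducible factors of `X * G` for an irreducible polynomial `G`. -/
theorem Polynomial.eq_X_or_eq_of_dvd_X_mul {k : Type*} [Field k] {P G : k[X]} (hP : Irreducible P)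
    (hPm : P.Monic) (hG : Irreducible G) (hGm : G.Monic) (h : P ∣ X * G) : P = X ∨ P = G := by
  rcases hP.prime.dvd_or_dvd h with h | h
  · exact .inl (eq_of_monic_of_associated hPm monic_X (hP.associated_of_dvd irreducible_X h))
  · exact .inr (eq_of_monic_of_associated hPm hGm (hP.associated_of_dvd hG h))

open Polynomial in
theorem Irreducible.map_ringEquiv {R S : Type*} [CommRing R] [CommRing S] {f : R[X]}
    (hf : Irreducible f) (e : R ≃+* S) : Irreducible (f.map (e : R →+* S)) :=
  (MulEquiv.irreducible_iff (mapEquiv e)).mpr hf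

open Polynomial in
/-- Over a semi-local ring with finite residue fields there is a monic polynomial with constant
term in a given ideal `I`, whose reductions are irreducible outside `V(I)` and `X` times an
irreducible polynomial of large degree on `V(I)`. -/
theorem exists_monic_separable_of_semilocal {B : Type u} [CommRing B] [Nontrivial B]
    [Finite (MaximalSpectrum B)] (hfin : ∀ m : Ideal B, m.IsMaximal → Finite (B ⧸ m))
    (I : Ideal B) {D : ℕ} (hD2 : 2 ≤ D) (hD : ∀ d, D ≤ d → 2 * d ≤ 2 ^ (d / 2)) :
    ∃ F : B[X], F.Monic ∧ F.Separable ∧ F.coeff 0 ∈ I ∧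
      ∀ (k : Type u) [Field k] (a : B →+* k), Function.Surjective a →
        (I ≤ RingHom.ker a → ∃ G : k[X], G.Monic ∧ Irreducible G ∧ G.natDegree = D ∧
          F.map a = X * G) ∧
        (¬ I ≤ RingHom.ker a → Irreducible (F.map a) ∧ D ≤ (F.map a).natDegree) := by
  classical
  have hex : ∀ (m : MaximalSpectrum B) (d : ℕ), D ≤ d →
      ∃ f : (B ⧸ m.asIdeal)[X], f.Monic ∧ Irreducible f ∧ f.natDegree = d := by
    intro m d hd
    have := hfin m.asIdeal m.isMaximal
    let := Ideal.Quotient.field m.asIdeal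
    have h1 := FiniteField.le_encard_monic_irreducible (K := B ⧸ m.asIdeal) (d := d) (M := 1)
      (by omega) (hD d hd)
    exact Set.one_le_encard_iff_nonempty.mp (by exact_mod_cast h1)
  choose g hgm hgi hgd using hex
  -- Both cases have degree D + 1, as reductions of a single monic polynomial must.
  let f : ∀ m : MaximalSpectrum B, (B ⧸ m.asIdeal)[X] := fun m =>
    if I ≤ m.asIdeal then X * g m D le_rfl else g m (D + 1) (Nat.le_succ D)
  have hf1 : ∀ m, I ≤ m.asIdeal → f m = X * g m D le_rfl := fun m hm => if_pos hm
  have hf2 : ∀ m, ¬ I ≤ m.asIdeal → f m = g m (D + 1) (Nat.le_succ D) := fun m hm => if_neg hm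
  obtain ⟨F, hF, hFI, hFm⟩ := exists_monic_forall_map_quotient_mk_eq I (N := D + 1)
    (Nat.succ_ne_zero D) f
    (fun m => by
      by_cases hm : I ≤ m.asIdeal
      · rw [hf1 m hm]; exact monic_X.mul (hgm _ _ _)
      · rw [hf2 m hm]; exact hgm _ _ _)
    (fun m => by
      by_cases hm : I ≤ m.asIdeal
      · have := Ideal.Quotient.nontrivial_iff.mpr m.isMaximal.ne_top
        rw [hf1 m hm, monic_X.natDegree_mul (hgm _ _ _), hgd, natDegree_X, add_comm]
      · rw [hf2 m hm, hgd])
    (fun m hm => by rw [hf1 m hm]; simp)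
  refine ⟨F, hF, ?_, hFI, ?_⟩
  · apply hF.separable_of_forall_maximal
    intro m hm
    have := hfin m hm
    let := Ideal.Quotient.field m
    rw [hFm ⟨m, hm⟩]
    by_cases hIm : I ≤ m
    · rw [hf1 ⟨m, hm⟩ hIm]
      -- X and the irreducible cofactor are coprime because the latter has degree D ≥ 2.
      refine separable_X.mul (PerfectField.separable_of_irreducible (hgi ⟨m, hm⟩ D le_rfl)) ?_
      rw [irreducible_X.coprime_iff_not_dvd]
      intro hdvd
      have h1 := eq_of_monic_of_associated monic_X (hgm ⟨m, hm⟩ D le_rfl)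
        (irreducible_X.associated_of_dvd (hgi ⟨m, hm⟩ D le_rfl) hdvd)
      have h2 := hgd ⟨m, hm⟩ D le_rfl
      rw [← h1, natDegree_X] at h2
      omega
    · rw [hf2 ⟨m, hm⟩ hIm]
      exact PerfectField.separable_of_irreducible (hgi ⟨m, hm⟩ _ _)
  · intro k _ a ha
    have hm : (RingHom.ker a).IsMaximal := RingHom.ker_isMaximal_of_surjective a ha
    obtain ⟨m, hma⟩ : ∃ m : MaximalSpectrum B, m.asIdeal = RingHom.ker a := ⟨⟨_, hm⟩, rfl⟩
    obtain ⟨e, hea⟩ : ∃ e : B ⧸ m.asIdeal ≃+* k,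
        (e : B ⧸ m.asIdeal →+* k).comp (Ideal.Quotient.mk m.asIdeal) = a :=
      ⟨(Ideal.quotEquivOfEq hma).trans (RingHom.quotientKerEquivOfSurjective ha), by ext; rfl⟩
    have he : F.map a = (f m).map (e : B ⧸ m.asIdeal →+* k) := by
      rw [← hFm m, map_map, hea]
    rw [← hma, he]
    refine ⟨fun hI => ?_, fun hI => ?_⟩
    · refine ⟨(g m D le_rfl).map (e : B ⧸ m.asIdeal →+* k), (hgm m D le_rfl).map _,
        (hgi m D le_rfl).map_ringEquiv e, ?_, ?_⟩
      · rw [(hgm m D le_rfl).natDegree_map, hgd]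
      · rw [hf1 m hI, Polynomial.map_mul, map_X]
    · rw [hf2 m hI]
      refine ⟨(hgi m _ _).map_ringEquiv e, ?_⟩
      rw [(hgm m _ _).natDegree_map, hgd]
      omega

open Polynomial in
/-- A field generated over `k` by a root of `F` is described by an irreducible factor of `F`. -/
theorem AdjoinRoot.exists_irreducible_of_surjective {B k l : Type*} [CommRing B] [Field k]
    [Field l] [Algebra k l] {F : B[X]} (hF : F.Monic) (a : B →+* k) (c : AdjoinRoot F →+* l)
    (hc : Function.Surjective c) (hac : c.comp (AdjoinRoot.of F) = (algebraMap k l).comp a) :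
    ∃ P : k[X], P.Monic ∧ Irreducible P ∧ P ∣ F.map a ∧ P.natDegree = Module.finrank k l ∧
      ∀ h : B[X], c (AdjoinRoot.mk F h) = 0 ↔ P ∣ h.map a := by
  have hmk : ∀ h : B[X], c (AdjoinRoot.mk F h) = aeval (c (AdjoinRoot.root F)) (h.map a) := by
    intro h
    rw [aeval_def, eval₂_map, ← hac, ← AdjoinRoot.aeval_eq, aeval_def, hom_eval₂]
    rfl
  have hint : IsIntegral k (c (AdjoinRoot.root F)) :=
    ⟨F.map a, hF.map a, by rw [← aeval_def, ← hmk, AdjoinRoot.mk_self, map_zero]⟩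
  refine ⟨minpoly k (c (AdjoinRoot.root F)), minpoly.monic hint, minpoly.irreducible hint, ?_,
    ?_, fun h => ?_⟩
  · rw [minpoly.dvd_iff, ← hmk, AdjoinRoot.mk_self, map_zero]
  · rw [← IntermediateField.adjoin.finrank hint]
    have : IntermediateField.adjoin k {c (AdjoinRoot.root F)} = ⊤ := by
      rw [eq_top_iff]
      intro y _
      obtain ⟨y, rfl⟩ := hc y
      obtain ⟨h, rfl⟩ := AdjoinRoot.mk_surjective y
      rw [hmk]
      exact IntermediateField.algebra_adjoin_le_adjoin k _
        (Algebra.adjoin_singleton_eq_range_aeval k (c (AdjoinRoot.root F)) ▸ ⟨_, rfl⟩)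
    rw [this, IntermediateField.finrank_top']
  · rw [hmk, minpoly.dvd_iff]

/-! ### Residue degrees and evaluation at points -/

namespace AlgebraicGeometry

variable {X Y Z : Scheme.{u}}

theorem Scheme.Hom.residueDegree_comp (f : X ⟶ Y) (g : Y ⟶ Z) (x : X) :
    (f ≫ g).residueDegree x = g.residueDegree (f x) * f.residueDegree x := by
  let := (f.residueFieldMap x).hom.toAlgebra
  let := (g.residueFieldMap (f x)).hom.toAlgebra
  let := (g.residueFieldMap (f x) ≫ f.residueFieldMap x).hom.toAlgebra
  have : IsScalarTower (Z.residueField (g (f x))) (Y.residueField (f x)) (X.residueField x) :=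
    .of_algebraMap_eq fun _ => rfl
  have h := Module.finrank_mul_finrank (Z.residueField (g (f x))) (Y.residueField (f x))
    (X.residueField x)
  unfold Scheme.Hom.residueDegree
  rw [Scheme.residueFieldMap_comp]
  exact h.symm

theorem Scheme.Hom.residueDegree_eq_one_iff (f : X ⟶ Y) (x : X) :
    f.residueDegree x = 1 ↔ Function.Bijective (f.residueFieldMap x) := by
  let := (f.residueFieldMap x).hom.toAlgebra
  exact Algebra.finrank_eq_one_iff_bijective_algebraMap

/-- The map of residue fields inherits surjectivity from the stalks. This covers closed immersions,
isomorphisms, inclusions of fibres and of residue field points. -/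
theorem Scheme.Hom.residueDegree_eq_one_of_surjectiveOnStalks (f : X ⟶ Y) [SurjectiveOnStalks f]
    (x : X) : f.residueDegree x = 1 := by
  rw [residueDegree_eq_one_iff]
  refine ⟨(f.residueFieldMap x).hom.injective, ?_⟩
  have h : Function.Surjective (f.stalkMap x ≫ X.residue x) :=
    (X.residue_surjective x).comp (f.stalkMap_surjective x)
  rw [← Scheme.residue_residueFieldMap] at h
  exact Function.Surjective.of_comp (g := Y.residue (f x)) h

theorem Scheme.Hom.residueDegree_eq_finrank (f : X ⟶ Y) (x : X) {k l : Type*} [Field k] [Field l]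
    [Algebra k l] (a : k →+* Y.residueField (f x)) (b : l →+* X.residueField x)
    (ha : Function.Bijective a) (hb : Function.Bijective b)
    (hab : b.comp (algebraMap k l) = (f.residueFieldMap x).hom.comp a) :
    f.residueDegree x = Module.finrank k l := by
  let := (f.residueFieldMap x).hom.toAlgebra
  exact (Algebra.finrank_eq_of_equiv_equiv (RingEquiv.ofBijective a ha)
    (RingEquiv.ofBijective b hb) hab.symm).symm

/-- Two sides of the fibre square have residue degree 1, so degrees in a fibre can be computed on
the total space. -/
theorem residueDegree_fiberToSpecResidueField (f : X ⟶ Y) (v : Y) (z : f.fiber v) :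
    (f.fiberToSpecResidueField v).residueDegree z = f.residueDegree (f.fiberι v z) := by
  have h1 := Scheme.Hom.residueDegree_comp (f.fiberι v) f z
  have h2 := Scheme.Hom.residueDegree_comp (f.fiberToSpecResidueField v)
    (Y.fromSpecResidueField v) z
  rw [Scheme.Hom.residueDegree_eq_one_of_surjectiveOnStalks (f.fiberι v), mul_one] at h1
  rw [Scheme.Hom.residueDegree_eq_one_of_surjectiveOnStalks (Y.fromSpecResidueField v),
    one_mul] at h2
  rw [← h1, ← h2, Scheme.Hom.fiber_fac]

/-- The evaluation of functions on `Spec R` at a point. -/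
noncomputable def Spec.evalAt {R : CommRingCat.{u}} (x : Spec R) :
    R →+* (Spec R).residueField x :=
  ((Scheme.ΓSpecIso R).inv ≫ (Spec R).Γevaluation x).hom

theorem Spec.exists_evalAt_eq {R : CommRingCat.{u}} (x : Spec R) :
    letI : x.asIdeal.IsPrime := x.2
    ∃ e : x.asIdeal.ResidueField ≃+* (Spec R).residueField x,
      evalAt x = (e : x.asIdeal.ResidueField →+* (Spec R).residueField x).comp
        (algebraMap R x.asIdeal.ResidueField) :=
  letI : x.asIdeal.IsPrime := x.2
  ⟨(Scheme.Spec.residueFieldIso R x).symm.commRingCatIsoToRingEquiv,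
    (congrArg CommRingCat.Hom.hom (Scheme.Spec.algebraMap_residueFieldIso_inv R x)).symm⟩

theorem Spec.ker_evalAt {R : CommRingCat.{u}} (x : Spec R) :
    RingHom.ker (evalAt x) = x.asIdeal := by
  have : x.asIdeal.IsPrime := x.2
  obtain ⟨e, he⟩ := exists_evalAt_eq x
  ext r
  rw [he, RingHom.mem_ker, RingHom.comp_apply, RingHom.coe_coe, map_eq_zero_iff e e.injective,
    Ideal.algebraMap_residueField_eq_zero]

theorem Spec.evalAt_surjective {R : CommRingCat.{u}} (x : Spec R) (hx : x.asIdeal.IsMaximal) :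
    Function.Surjective (evalAt x) := by
  obtain ⟨e, he⟩ := exists_evalAt_eq x
  rw [he, RingHom.coe_comp]
  exact e.surjective.comp (Ideal.algebraMap_residueField_surjective _)

theorem Spec.residueFieldMap_comp_evalAt {R S : CommRingCat.{u}} (φ : R ⟶ S) (x : Spec S) :
    ((Spec.map φ).residueFieldMap x).hom.comp (evalAt ((Spec.map φ) x)) =
      (evalAt x).comp φ.hom := by
  have : ((Scheme.ΓSpecIso R).inv ≫ (Spec R).Γevaluation ((Spec.map φ) x)) ≫
      (Spec.map φ).residueFieldMap x =
      φ ≫ ((Scheme.ΓSpecIso S).inv ≫ (Spec S).Γevaluation x) := by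
    rw [Category.assoc, Scheme.Γevaluation_naturality, Scheme.ΓSpecIso_inv_naturality_assoc]
  exact congrArg CommRingCat.Hom.hom this

end AlgebraicGeometry

/-! ### Points of the affine line over a field -/

namespace AlgebraicGeometry

theorem Spec.asIdeal_isMaximal_of_isField {R : CommRingCat.{u}} (hR : IsField R) (x : Spec R) :
    x.asIdeal.IsMaximal := by
  let := hR.toField
  have h : x.asIdeal = ⊥ := (Ideal.eq_bot_or_top x.asIdeal).resolve_right x.2.ne_top
  rw [h]
  exact Ideal.bot_isMaximal

theorem Spec.evalAt_bijective_of_isField {R : CommRingCat.{u}} (hR : IsField R) (x : Spec R) :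
    Function.Bijective (evalAt x) := by
  refine ⟨?_, evalAt_surjective x (asIdeal_isMaximal_of_isField hR x)⟩
  let := hR.toField
  exact (evalAt x).injective

theorem Spec.residueDegree_map_algebraMap (K L : Type u) [Field K] [Field L] [Algebra K L]
    (x : Spec (CommRingCat.of L)) :
    (Spec.map (CommRingCat.ofHom (algebraMap K L))).residueDegree x = Module.finrank K L :=
  Scheme.Hom.residueDegree_eq_finrank _ x
    (evalAt (R := .of K) ((Spec.map (CommRingCat.ofHom (algebraMap K L))) x)) (evalAt x)
    (evalAt_bijective_of_isField (R := .of K) (Field.toIsField K) _)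
    (evalAt_bijective_of_isField (R := .of L) (Field.toIsField L) x)
    (residueFieldMap_comp_evalAt (CommRingCat.ofHom (algebraMap K L)) x).symm

/-- The evaluation of polynomials on the affine line. -/
noncomputable def AffineSpace.lineSection (K : Type u) [Field K] :
    Polynomial K →+* Γ(𝔸(PUnit.{u + 1}; Spec (CommRingCat.of K)), ⊤) :=
  Polynomial.eval₂RingHom
    ((Scheme.ΓSpecIso (CommRingCat.of K)).inv ≫
      (𝔸(PUnit.{u + 1}; Spec (CommRingCat.of K)) ↘ Spec (CommRingCat.of K)).appTop).hom
    (AffineSpace.coord _ PUnit.unit)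

open _root_.Polynomial in
/-- The closed point of the affine line that is defined by an irreducible polynomial. -/
theorem AffineSpace.exists_point_of_irreducible {K : Type u} [Field K] {f : K[X]}
    (hf : Irreducible f) :
    ∃ x : 𝔸(PUnit.{u + 1}; Spec (CommRingCat.of K)),
      (𝔸(PUnit.{u + 1}; Spec (CommRingCat.of K)) ↘ Spec (CommRingCat.of K)).residueDegree x =
        f.natDegree ∧
      ∀ h : K[X], (Scheme.Γevaluation _ x) (lineSection K h) = 0 ↔ f ∣ h := by
  have : Fact (Irreducible f) := ⟨hf⟩
  let L := CommRingCat.of (AdjoinRoot f)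
  let φ : CommRingCat.of K ⟶ L := CommRingCat.ofHom (algebraMap K (AdjoinRoot f))
  -- The root of f defines a closed immersion of Spec K[X]/(f) into the line; the image of its point
  -- is the desired one.
  let g : Spec L ⟶ 𝔸(PUnit.{u + 1}; Spec (CommRingCat.of K)) :=
    AffineSpace.homOfVector (Spec.map φ) fun _ => (Scheme.ΓSpecIso L).inv (AdjoinRoot.root f)
  have hg : g ≫ (𝔸(PUnit.{u + 1}; Spec (CommRingCat.of K)) ↘ Spec (CommRingCat.of K)) =
      Spec.map φ := AffineSpace.homOfVector_over _ _
  have hcomp : g.appTop.hom.comp (lineSection K) =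
      (Scheme.ΓSpecIso L).inv.hom.comp (AdjoinRoot.mk f) := by
    apply Polynomial.ringHom_ext
    · intro c
      have h1 : (Scheme.ΓSpecIso (CommRingCat.of K)).inv ≫
          (𝔸(PUnit.{u + 1}; Spec (CommRingCat.of K)) ↘ Spec (CommRingCat.of K)).appTop ≫
            g.appTop = φ ≫ (Scheme.ΓSpecIso L).inv := by
        rw [← Scheme.Hom.comp_appTop, hg, Scheme.ΓSpecIso_inv_naturality]
      rw [RingHom.comp_apply, lineSection, coe_eval₂RingHom, eval₂_C]
      exact congrArg (fun t => t.hom c) h1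
    · have h1 := AffineSpace.homOfVector_appTop_coord (Spec.map φ)
        (fun _ : PUnit.{u + 1} => (Scheme.ΓSpecIso L).inv (AdjoinRoot.root f)) PUnit.unit
      rw [RingHom.comp_apply, lineSection, coe_eval₂RingHom, eval₂_X]
      exact h1
  have hsurj : Function.Surjective g.appTop := by
    intro y
    obtain ⟨h, hh⟩ := AdjoinRoot.mk_surjective ((Scheme.ΓSpecIso L).hom y)
    refine ⟨lineSection K h, ?_⟩
    have h1 := RingHom.congr_fun hcomp h
    rw [RingHom.comp_apply, RingHom.comp_apply, hh] at h1
    exact h1.trans (by simp)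
  have hcl : IsClosedImmersion g := .of_surjective_of_isAffine g hsurj
  obtain ⟨x⟩ : Nonempty (Spec L) := inferInstanceAs (Nonempty (PrimeSpectrum (AdjoinRoot f)))
  refine ⟨g x, ?_, fun h => ?_⟩
  · have h1 := Scheme.Hom.residueDegree_comp g
      (𝔸(PUnit.{u + 1}; Spec (CommRingCat.of K)) ↘ Spec (CommRingCat.of K)) x
    rw [hg, Scheme.Hom.residueDegree_eq_one_of_surjectiveOnStalks g, mul_one] at h1
    rw [← h1, Spec.residueDegree_map_algebraMap]
    exact finrank_quotient_span_eq_natDegree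
  · have h1 : (g.residueFieldMap x) ((Scheme.Γevaluation _ (g x)) (lineSection K h)) =
        Spec.evalAt x (AdjoinRoot.mk f h) := by
      rw [Scheme.Γevaluation_naturality_apply]
      have h2 := RingHom.congr_fun hcomp h
      exact congrArg ((Spec L).Γevaluation x) h2
    rw [← AdjoinRoot.mk_eq_zero,
      ← map_eq_zero_iff _ (Spec.evalAt_bijective_of_isField (R := L) (Field.toIsField _) x).1, ← h1]
    exact (map_eq_zero_iff _ (g.residueFieldMap x).hom.injective).symm

-- The polynomials vanishing at the point attached to f are the multiples of f, so the point
-- determines the monic f.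
open _root_.Polynomial in
theorem AffineSpace.encard_monic_irreducible_le_numPointsOfDegree (K : Type u) [Field K] (d : ℕ) :
    {f : K[X] | f.Monic ∧ Irreducible f ∧ f.natDegree = d}.encard ≤
      numPointsOfDegree
        (𝔸(PUnit.{u + 1}; Spec (CommRingCat.of K)) ↘ Spec (CommRingCat.of K)) d := by
  choose x hx1 hx2 using fun f : {f : K[X] | f.Monic ∧ Irreducible f ∧ f.natDegree = d} =>
    AffineSpace.exists_point_of_irreducible f.2.2.1
  rw [numPointsOfDegree, ← ENat.card_coe_set_eq, ← ENat.card_coe_set_eq]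
  apply ENat.card_le_card_of_injective
    (f := fun f => ⟨x f, (hx1 f).trans f.2.2.2⟩)
  intro f f' hff
  have hx : x f = x f' := congrArg Subtype.val hff
  have h1 : (f : K[X]) ∣ f' := by
    rw [← hx2 f, hx, hx2]
  exact Subtype.ext (eq_of_monic_of_associated f.2.1 f'.2.1
    (f.2.2.1.associated_of_dvd f'.2.2.1 h1))

end AlgebraicGeometry

/-! ### The finite étale cover and its points -/

open Polynomial AlgebraicGeometry.Spec in
/-- The fibre of `Spec B[X]/(F)` over a closed point `s` in terms of the irreducible factors of `F`
over the residue field of `s`. -/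
theorem AdjoinRoot.exists_irreducible_of_map_eq {B : CommRingCat.{u}} {F : B[X]} (hF : F.Monic)
    (z : Spec (CommRingCat.of (AdjoinRoot F))) (s : Spec B)
    (hzs : (Spec.map (CommRingCat.ofHom (AdjoinRoot.of F))) z = s) (hs : s.asIdeal.IsMaximal) :
    ∃ P : ((Spec B).residueField s)[X], P.Monic ∧ Irreducible P ∧ P ∣ F.map (evalAt s) ∧
      P.natDegree = (Spec.map (CommRingCat.ofHom (AdjoinRoot.of F))).residueDegree z ∧
      ∀ h : B[X], AdjoinRoot.mk F h ∈ z.asIdeal ↔ P ∣ h.map (evalAt s) := by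
  subst hzs
  let := ((Spec.map (CommRingCat.ofHom (AdjoinRoot.of F))).residueFieldMap z).hom.toAlgebra
  have hfin := hF.finite_adjoinRoot
  have hint : (AdjoinRoot.of F).IsIntegral := algebraMap_isIntegral_iff.mpr inferInstance
  have hz : z.asIdeal.IsMaximal := by
    have := z.2
    exact Ideal.isMaximal_of_isIntegral_of_isMaximal_comap' (AdjoinRoot.of F) hint z.asIdeal hs
  obtain ⟨P, hPm, hPi, hPF, hPd, hP⟩ := AdjoinRoot.exists_irreducible_of_surjective hF
    (k := (Spec B).residueField ((Spec.map (CommRingCat.ofHom (AdjoinRoot.of F))) z))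
    (l := (Spec (CommRingCat.of (AdjoinRoot F))).residueField z)
    (evalAt _) (evalAt z) (evalAt_surjective z hz)
    (residueFieldMap_comp_evalAt (CommRingCat.ofHom (AdjoinRoot.of F)) z).symm
  refine ⟨P, hPm, hPi, hPF, hPd, fun h => ?_⟩
  rw [← hP, ← ker_evalAt z, RingHom.mem_ker]

open Polynomial AlgebraicGeometry.Spec in
/-- A finite étale extension of a semi-local domain `B` along which `B ⧸ I` lifts, with a single
point over each closed point outside `V(I)` and two points of different degrees over each closed
point of `V(I)`; all these degrees but those of the points in the image of `V(I)` are large. -/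
theorem exists_finite_etale_of_semilocal {B : CommRingCat.{u}} [IsDomain B]
    [Finite (MaximalSpectrum B)] (hfin : ∀ m : Ideal B, m.IsMaximal → Finite (B ⧸ m))
    (I : Ideal B) {D : ℕ} (hD2 : 2 ≤ D) (hD : ∀ d, D ≤ d → 2 * d ≤ 2 ^ (d / 2))
    (m₀ : Ideal B) [m₀.IsMaximal] (hm₀ : ¬ I ≤ m₀)
    [IsRegularLocalRing (Localization.AtPrime m₀)] :
    ∃ (C : CommRingCat.{u}) (φ : B ⟶ C) (δ : C ⟶ CommRingCat.of (B ⧸ I)),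
      IsDomain C ∧ φ.hom.Finite ∧ φ.hom.Etale ∧
      φ ≫ δ = CommRingCat.ofHom (Ideal.Quotient.mk I) ∧
      (∀ z z' : Spec C, (Spec.map φ) z = (Spec.map φ) z' → ((Spec.map φ) z).asIdeal.IsMaximal →
        (Spec.map φ).residueDegree z = (Spec.map φ).residueDegree z' → z = z') ∧
      ∀ z : Spec C, ((Spec.map φ) z).asIdeal.IsMaximal → D ≤ (Spec.map φ).residueDegree z ∨
        (I ≤ ((Spec.map φ) z).asIdeal ∧ (Spec.map φ).residueDegree z = 1) := by
  obtain ⟨F, hF, hFs, hFI, hFk⟩ := exists_monic_separable_of_semilocal hfin I hD2 hD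
  have hfinite := hF.finite_adjoinRoot
  have hmax : Irreducible (F.map (Ideal.Quotient.mk m₀)) := by
    let := Ideal.Quotient.field m₀
    refine ((hFk (B ⧸ m₀) (Ideal.Quotient.mk m₀) Ideal.Quotient.mk_surjective).2 ?_).1
    rwa [Ideal.mk_ker]
  have hdom := AdjoinRoot.isDomain_of_irreducible_map_quotient m₀ hF hmax
  have hfac : ∀ (z : Spec (CommRingCat.of (AdjoinRoot F))) (s : Spec B),
      (Spec.map (CommRingCat.ofHom (AdjoinRoot.of F))) z = s → s.asIdeal.IsMaximal →
      ∃ P : ((Spec B).residueField s)[X],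
        P.natDegree = (Spec.map (CommRingCat.ofHom (AdjoinRoot.of F))).residueDegree z ∧
        (∀ h : B[X], AdjoinRoot.mk F h ∈ z.asIdeal ↔ P ∣ h.map (evalAt s)) ∧
        ((I ≤ s.asIdeal ∧ ∃ G : ((Spec B).residueField s)[X], G.natDegree = D ∧
          F.map (evalAt s) = X * G ∧ G.Monic ∧ (P = X ∨ P = G)) ∨
          (P = F.map (evalAt s) ∧ D ≤ P.natDegree)) := by
    intro z s hzs hs
    obtain ⟨P, hPm, hPi, hPF, hPd, hP⟩ := AdjoinRoot.exists_irreducible_of_map_eq hF z s hzs hs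
    refine ⟨P, hPd, hP, ?_⟩
    have h1 := hFk ((Spec B).residueField s) (evalAt s) (evalAt_surjective s hs)
    rw [ker_evalAt] at h1
    by_cases hI : I ≤ s.asIdeal
    · obtain ⟨G, hGm, hGi, hGd, hG⟩ := h1.1 hI
      exact .inl ⟨hI, G, hGd, hG, hGm, eq_X_or_eq_of_dvd_X_mul hPi hPm hGi hGm (hG ▸ hPF)⟩
    · have hPeq : P = F.map (evalAt s) := eq_of_monic_of_associated hPm (hF.map _)
        (hPi.associated_of_dvd (h1.2 hI).1 hPF)
      exact .inr ⟨hPeq, hPeq ▸ (h1.2 hI).2⟩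
  refine ⟨.of (AdjoinRoot F), CommRingCat.ofHom (AdjoinRoot.of F),
    -- The section X = 0 exists over B/I because F(0) ∈ I.
    CommRingCat.ofHom (AdjoinRoot.lift (Ideal.Quotient.mk I) 0 ?_), hdom, ?_, ?_, ?_, ?_, ?_⟩
  · rw [eval₂_at_zero]
    exact Ideal.Quotient.eq_zero_iff_mem.mpr hFI
  · exact RingHom.finite_algebraMap.mpr hfinite
  · exact RingHom.etale_algebraMap.mpr (AdjoinRoot.etale_of_separable hF hFs)
  · ext b
    simp
  · intro z z' hzz hs hdeg
    obtain ⟨P, hPd, hP, hPc⟩ := hfac z _ rfl hs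
    obtain ⟨P', hPd', hP', hPc'⟩ := hfac z' _ hzz.symm hs
    -- The possible factors over one closed point have distinct degrees: 1 and D for X and G, or D +
    -- 1 for the whole reduction. So the degree determines the factor, and the factor the point.
    have hPP : P = P' := by
      rcases hPc with ⟨hI, G, hGd, hFG, hGm, hPc⟩ | ⟨hPc, hPD⟩ <;>
        rcases hPc' with ⟨hI', G', hGd', hFG', hGm', hPc'⟩ | ⟨hPc', hPD'⟩
      · have hGG : G = G' := mul_left_cancel₀ X_ne_zero (hFG.symm.trans hFG')
        subst hGG
        rcases hPc with rfl | rfl <;> rcases hPc' with rfl | rfl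
        · rfl
        · rw [natDegree_X] at hPd; omega
        · rw [natDegree_X] at hPd'; omega
        · rfl
      · have h2 := congrArg natDegree hFG
        rw [← hPc', natDegree_X_mul hGm.ne_zero] at h2
        rcases hPc with rfl | rfl
        · rw [natDegree_X] at hPd; omega
        · omega
      · have h2 := congrArg natDegree hFG'
        rw [← hPc, natDegree_X_mul hGm'.ne_zero] at h2
        rcases hPc' with rfl | rfl
        · rw [natDegree_X] at hPd'; omega
        · omega
      · rw [hPc, hPc']
    apply PrimeSpectrum.ext
    ext y
    obtain ⟨h, rfl⟩ := AdjoinRoot.mk_surjective y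
    rw [hP, hP', hPP]
  · intro z hs
    obtain ⟨P, hPd, -, hPc⟩ := hfac z _ rfl hs
    rcases hPc with ⟨hI, G, hGd, -, -, rfl | rfl⟩ | ⟨-, hPD⟩
    · exact .inr ⟨hI, by rw [← hPd, natDegree_X]⟩
    · exact .inl (by rw [← hPd, hGd])
    · exact .inl (hPd ▸ hPD)

/-! ### Counting points in the fibres -/

/-- The conclusions about a fibre, from the degrees of the points of `S''` over `S'`. -/
theorem fiber_conditions {B : CommRingCat.{u}} {U S'' T' : Scheme.{u}} (p : Spec B ⟶ U)
    (i : T' ⟶ Spec B) [IsClosedImmersion i] [IsIso (i ≫ p)] (ρ : S'' ⟶ Spec B) (δ' : T' ⟶ S'')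
    (hδ : δ' ≫ ρ = i) {M D : ℕ} (hD2 : 2 ≤ D) (hD : ∀ d, D ≤ d → (M + 1) * d ≤ 2 ^ (d / 2))
    (hM : {s : Spec B | IsClosed ({s} : Set (Spec B))}.encard ≤ M)
    (hres : ∀ s : Spec B, IsClosed ({s} : Set (Spec B)) → Finite ((Spec B).residueField s))
    (hinj : ∀ z z' : S'', ρ z = ρ z' → IsClosed ({ρ z} : Set (Spec B)) →
      ρ.residueDegree z = ρ.residueDegree z' → z = z')
    (hdeg : ∀ z : S'', IsClosed ({ρ z} : Set (Spec B)) → D ≤ ρ.residueDegree z ∨ ∃ t, z = δ' t)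
    (v : U) (hv : IsClosed ({v} : Set U)) :
    (∃! v' : T', (i ≫ p) v' = v) ∧
      (∀ v' : T', (i ≫ p) v' = v →
        ∃ z₀ : (ρ ≫ p).fiber v, (ρ ≫ p).fiberι v z₀ = δ' v' ∧
          ∀ z : (ρ ≫ p).fiber v,
            IsRationalPoint ((ρ ≫ p).fiberToSpecResidueField v) z ↔ z = z₀) ∧
      ∀ d : ℕ, 1 ≤ d →
        numPointsOfDegree ((ρ ≫ p).fiberToSpecResidueField v) d ≤
          numPointsOfDegree
            (𝔸(PUnit.{u + 1}; Spec (U.residueField v)) ↘ Spec (U.residueField v)) d := by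
  have hbij : Function.Bijective (i ≫ p) :=
    ⟨(i ≫ p).homeomorph.injective, (i ≫ p).homeomorph.surjective⟩
  have huniq : ∃! v' : T', (i ≫ p) v' = v := hbij.existsUnique v
  obtain ⟨t₀, ht₀, ht₀u⟩ := id huniq
  have hcomp : δ' ≫ ρ ≫ p = i ≫ p := by rw [← Category.assoc, hδ]
  have hit : ∀ t, ρ (δ' t) = i t := fun t => by rw [← hδ]; rfl
  have hpt : (ρ ≫ p) (δ' t₀) = v := by rw [← ht₀, ← hcomp]; rfl
  have ht₀c : IsClosed ({t₀} : Set T') := by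
    have : ({t₀} : Set T') = (i ≫ p) ⁻¹' {v} := by
      ext t
      exact ⟨fun h => h ▸ ht₀, fun h => ht₀u t h⟩
    rw [this]
    exact hv.preimage (i ≫ p).continuous
  have hitc : IsClosed ({i t₀} : Set (Spec B)) := by
    rw [← Set.image_singleton]
    exact i.isClosedEmbedding.isClosedMap _ ht₀c
  have hδdeg : (ρ ≫ p).residueDegree (δ' t₀) = 1 := by
    have h1 := Scheme.Hom.residueDegree_comp δ' (ρ ≫ p) t₀
    rw [hcomp, Scheme.Hom.residueDegree_eq_one_of_surjectiveOnStalks (i ≫ p)] at h1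
    exact (Nat.eq_one_of_mul_eq_one_right h1.symm)
  have hK : Finite (U.residueField v) := by
    have := hres _ hitc
    subst ht₀
    exact Finite.of_injective (p.residueFieldMap (i t₀)) (p.residueFieldMap (i t₀)).hom.injective
  -- Nonzero residue degree means a finite extension, so the residue field at ρ(z) is finite, and B
  -- modulo the corresponding prime is a finite domain, hence a field.
  have hcl : ∀ z : S'', (ρ ≫ p) z = v → (ρ ≫ p).residueDegree z ≠ 0 →
      IsClosed ({ρ z} : Set (Spec B)) := by
    intro z hz hne
    subst hz
    rw [Scheme.Hom.residueDegree_comp] at hne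
    have h1 : p.residueDegree (ρ z) ≠ 0 := left_ne_zero_of_mul hne
    have : Finite ((Spec B).residueField (ρ z)) := by
      let := (p.residueFieldMap (ρ z)).hom.toAlgebra
      have : Module.Finite (U.residueField (p (ρ z))) ((Spec B).residueField (ρ z)) :=
        Module.finite_of_finrank_pos (Nat.pos_of_ne_zero h1)
      have : Finite (U.residueField (p (ρ z))) := hK
      exact Module.finite_of_finite (U.residueField (p (ρ z)))
    apply (PrimeSpectrum.isClosed_singleton_iff_isMaximal _).mpr
    have h2 : Finite (B ⧸ (ρ z).asIdeal) := by
      rw [← Spec.ker_evalAt]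
      exact Finite.of_injective _ (RingHom.kerLift_injective (Spec.evalAt (ρ z)))
    have := (ρ z).2
    exact Ideal.Quotient.maximal_of_isField _ (Finite.isField_of_domain _)
  -- Total degree 1 forces degree 1 < D over S', so z lies on the lift of T', which has a single
  -- point over v.
  have hone : ∀ z : S'', (ρ ≫ p) z = v → (ρ ≫ p).residueDegree z = 1 → z = δ' t₀ := by
    intro z hz h1
    have hc := hcl z hz (by omega)
    rw [Scheme.Hom.residueDegree_comp] at h1
    rcases hdeg z hc with h2 | ⟨t, rfl⟩
    · have := Nat.eq_one_of_mul_eq_one_left h1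
      omega
    · rw [ht₀u t]
      rw [← hz, ← hcomp]
      rfl
  have hfib : ∀ z : (ρ ≫ p).fiber v, (ρ ≫ p) ((ρ ≫ p).fiberι v z) = v := by
    intro z
    have : (ρ ≫ p).fiberι v z ∈ Set.range ((ρ ≫ p).fiberι v) := ⟨z, rfl⟩
    rw [Scheme.Hom.range_fiberι] at this
    exact this
  have hιinj : Function.Injective ((ρ ≫ p).fiberι v) := ((ρ ≫ p).fiberι v).isEmbedding.injective
  refine ⟨huniq, ?_, ?_⟩
  · intro v' hv'
    obtain rfl := ht₀u v' hv'
    obtain ⟨z₀, hz₀⟩ : δ' v' ∈ Set.range ((ρ ≫ p).fiberι v) := by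
      rw [Scheme.Hom.range_fiberι]
      exact hpt
    refine ⟨z₀, hz₀, fun z => ?_⟩
    rw [IsRationalPoint, ← Scheme.Hom.residueDegree_eq_one_iff,
      residueDegree_fiberToSpecResidueField]
    constructor
    · intro h
      exact hιinj ((hone _ (hfib z) h).trans hz₀.symm)
    · rintro rfl
      rw [hz₀, hδdeg]
  · intro d hd
    refine le_trans ?_
      (AffineSpace.encard_monic_irreducible_le_numPointsOfDegree (U.residueField v) d)
    have hstep : {w : (ρ ≫ p).fiber v |
        ((ρ ≫ p).fiberToSpecResidueField v).residueDegree w = d}.encard ≤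
        {z : S'' | (ρ ≫ p) z = v ∧ (ρ ≫ p).residueDegree z = d}.encard := by
      rw [← hιinj.encard_image]
      apply Set.encard_le_encard
      rintro _ ⟨w, hw, rfl⟩
      exact ⟨hfib w, by rw [← residueDegree_fiberToSpecResidueField]; exact hw⟩
    refine hstep.trans ?_
    rcases hd.eq_or_lt with rfl | hd2
    · have h1 : {z : S'' | (ρ ≫ p) z = v ∧ (ρ ≫ p).residueDegree z = 1} ⊆ {δ' t₀} :=
        fun z hz => hone z hz.1 hz.2
      refine (Set.encard_le_encard h1).trans ?_
      rw [Set.encard_singleton, Set.one_le_encard_iff_nonempty]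
      exact ⟨Polynomial.X, Polynomial.monic_X, Polynomial.irreducible_X, Polynomial.natDegree_X⟩
    · have hlarge : ∀ z : S'', (ρ ≫ p) z = v → (ρ ≫ p).residueDegree z = d → D ≤ d := by
        intro z hz hzd
        rcases hdeg z (hcl z hz (by omega)) with h2 | ⟨t, rfl⟩
        · rw [Scheme.Hom.residueDegree_comp] at hzd
          have h3 : p.residueDegree (ρ z) ≠ 0 := by
            intro h0
            rw [h0, zero_mul] at hzd
            omega
          calc D ≤ ρ.residueDegree z := h2
            _ ≤ p.residueDegree (ρ z) * ρ.residueDegree z :=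
              Nat.le_mul_of_pos_left _ (Nat.pos_of_ne_zero h3)
            _ = d := hzd
        · have ht : t = t₀ := ht₀u t (by rw [← hz, ← hcomp]; rfl)
          rw [ht, hδdeg] at hzd
          omega
      by_cases hDd : D ≤ d
      · refine le_trans ?_ (FiniteField.le_encard_monic_irreducible (M := M) (by omega) (hD d hDd))
        refine le_trans ?_ hM
        -- Points over the same s with the same total degree have the same degree over s, so they
        -- coincide; hence at most M points, one per closed point of S'.
        have hinjOn : Set.InjOn ρ {z : S'' | (ρ ≫ p) z = v ∧ (ρ ≫ p).residueDegree z = d} := by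
          intro z hz z' hz' hzz
          have hc := hcl z hz.1 (by rw [hz.2]; omega)
          refine hinj z z' hzz hc ?_
          have h1 := hz.2
          have h2 := hz'.2
          rw [Scheme.Hom.residueDegree_comp] at h1 h2
          rw [← hzz, ← h1] at h2
          refine (Nat.eq_of_mul_eq_mul_left (Nat.pos_of_ne_zero fun h0 => ?_) h2).symm
          rw [h0, zero_mul] at h1
          omega
        rw [← hinjOn.encard_image]
        apply Set.encard_le_encard
        rintro _ ⟨z, hz, rfl⟩
        exact hcl z hz.1 (by rw [hz.2]; omega)
      · have : {z : S'' | (ρ ≫ p) z = v ∧ (ρ ≫ p).residueDegree z = d} = ∅ := by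
          rw [Set.eq_empty_iff_forall_notMem]
          exact fun z hz => hDd (hlarge z hz.1 hz.2)
        rw [this, Set.encard_empty]
        exact zero_le

/-! ### Assembling the cover -/

/-- The main theorem for an affine scheme `Spec B`, with the hypotheses that its proof uses. -/
theorem exists_finite_etale_of_section {B : CommRingCat.{u}} [IsDomain B]
    {U T' : Scheme.{u}} (p : Spec B ⟶ U)
    (hreg : ∀ s : Spec B, IsRegularLocalRing ((Spec B).presheaf.stalk s))
    (hsemi : {s : Spec B | IsClosed ({s} : Set (Spec B))}.Finite)
    (hres : ∀ s : Spec B, IsClosed ({s} : Set (Spec B)) → Finite ((Spec B).residueField s))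
    (i : T' ⟶ Spec B) [IsClosedImmersion i] [IsIso (i ≫ p)] :
    ∃ (S'' : Scheme.{u}) (ρ : S'' ⟶ Spec B) (δ' : T' ⟶ S''),
      IrreducibleSpace S'' ∧ IsFinite ρ ∧ Etale ρ ∧ δ' ≫ ρ = i ∧
      ∀ v : U, IsClosed ({v} : Set U) →
        (∃! v' : T', (i ≫ p) v' = v) ∧
        (∀ v' : T', (i ≫ p) v' = v →
          ∃ z₀ : (ρ ≫ p).fiber v, (ρ ≫ p).fiberι v z₀ = δ' v' ∧
            ∀ z : (ρ ≫ p).fiber v,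
              IsRationalPoint ((ρ ≫ p).fiberToSpecResidueField v) z ↔ z = z₀) ∧
        ∀ d : ℕ, 1 ≤ d →
          numPointsOfDegree ((ρ ≫ p).fiberToSpecResidueField v) d ≤
            numPointsOfDegree
              (𝔸(PUnit.{u + 1}; Spec (U.residueField v)) ↘ Spec (U.residueField v)) d := by
  obtain ⟨M, hM⟩ : ∃ M : ℕ, {s : Spec B | IsClosed ({s} : Set (Spec B))}.encard ≤ M :=
    ⟨_, hsemi.encard_eq_coe_toFinset_card.le⟩
  -- M + 2 serves two bounds: factor M + 1 for the point count, and factor 2 for the existence of an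
  -- irreducible polynomial of each degree ≥ D.
  obtain ⟨D, hD2, hD⟩ := exists_forall_mul_le_two_pow_half (M + 2)
  have hD1 : ∀ d, D ≤ d → (M + 1) * d ≤ 2 ^ (d / 2) := fun d hd =>
    (Nat.mul_le_mul_right d (by omega)).trans (hD d hd)
  have hcl : ∀ s : Spec B, IsClosed ({s} : Set (Spec B)) ↔ s.asIdeal.IsMaximal := fun s =>
    PrimeSpectrum.isClosed_singleton_iff_isMaximal s
  -- A closed point off T' is what makes the constructed cover irreducible; if there is none, S'
  -- itself already has the required fibres.
  by_cases hall : ∀ s : Spec B, IsClosed ({s} : Set (Spec B)) → s ∈ Set.range i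
  · refine ⟨Spec B, 𝟙 _, i, inferInstanceAs (IrreducibleSpace (PrimeSpectrum B)), inferInstance,
      inferInstance, Category.comp_id i, ?_⟩
    refine fiber_conditions p i (𝟙 _) i (Category.comp_id i) hD2 hD1 hM hres
      (fun z z' h _ _ => h) fun z hz => .inr ?_
    obtain ⟨t, ht⟩ := hall _ hz
    exact ⟨t, ht.symm⟩
  · push Not at hall
    obtain ⟨s₀, hs₀, hs₀i⟩ := hall
    obtain ⟨I, e, he⟩ := IsClosedImmersion.Spec_iff.mp ‹IsClosedImmersion i›
    have hrange : ∀ s : Spec B, I ≤ s.asIdeal → s ∈ Set.range i := by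
      intro s hs
      have h1 : s ∈ Set.range (Spec.map (CommRingCat.ofHom (Ideal.Quotient.mk I))) := by
        have h2 := range_comap_of_surjective _ (Ideal.Quotient.mk I) Ideal.Quotient.mk_surjective
        rw [Ideal.mk_ker] at h2
        exact h2.symm ▸ (show s ∈ PrimeSpectrum.zeroLocus (I : Set B) from hs)
      obtain ⟨t, ht⟩ := h1
      refine ⟨e.inv t, ?_⟩
      have h2 : e.inv ≫ i = Spec.map (CommRingCat.ofHom (Ideal.Quotient.mk I)) := by
        rw [he, Iso.inv_hom_id_assoc]
      rw [← Scheme.Hom.comp_apply, h2]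
      exact ht
    have hmax : s₀.asIdeal.IsMaximal := (hcl s₀).mp hs₀
    have hfinM : Finite (MaximalSpectrum B) := by
      have := hsemi.to_subtype
      refine Finite.of_injective (β := {s : Spec B | IsClosed ({s} : Set (Spec B))})
        (fun m => ⟨⟨m.asIdeal, m.isMaximal.isPrime⟩, (hcl _).mpr m.isMaximal⟩) ?_
      intro m m' h
      exact MaximalSpectrum.ext (congrArg (fun s => s.1.asIdeal) h)
    have hfinres : ∀ m : Ideal B, m.IsMaximal → Finite (B ⧸ m) := by
      intro m hm
      let s : Spec B := ⟨m, hm.isPrime⟩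
      have h1 := hres s ((hcl s).mpr hm)
      have h2 : Finite (B ⧸ RingHom.ker (Spec.evalAt s)) :=
        Finite.of_injective _ (RingHom.kerLift_injective (Spec.evalAt s))
      rwa [Spec.ker_evalAt] at h2
    have hregs : IsRegularLocalRing (Localization.AtPrime s₀.asIdeal) := by
      have := hreg s₀
      exact IsRegularLocalRing.of_ringEquiv (Spec.stalkIso B s₀).commRingCatIsoToRingEquiv
    obtain ⟨C, φ, δ, hC, hφf, hφe, hφδ, hinj, hdeg⟩ :=
      exists_finite_etale_of_semilocal hfinres I hD2
        (fun d hd => (Nat.mul_le_mul_right d (by omega)).trans (hD d hd)) s₀.asIdeal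
        (fun h => hs₀i (hrange s₀ h))
    have hδ : (e.hom ≫ Spec.map δ) ≫ Spec.map φ = i := by
      rw [Category.assoc, ← Spec.map_comp, hφδ, he]
    refine ⟨Spec C, Spec.map φ, e.hom ≫ Spec.map δ,
      inferInstanceAs (IrreducibleSpace (PrimeSpectrum C)), (IsFinite.SpecMap_iff φ).mpr hφf,
      (HasRingHomProperty.Spec_iff (P := @Etale)).mpr hφe, hδ, ?_⟩
    refine fiber_conditions p i _ _ hδ hD2 hD1 hM hres
      (fun z z' h hz hzz => hinj z z' h ((hcl _).mp hz) hzz) fun z hz => ?_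
    refine (hdeg z ((hcl _).mp hz)).imp_right fun h => ?_
    obtain ⟨t, ht⟩ := hrange _ h.1
    have ht' : (Spec.map φ) ((e.hom ≫ Spec.map δ) t) = (Spec.map φ) z := by
      rw [← ht, ← Scheme.Hom.comp_apply, hδ]
    -- The lifted point over the same s also has degree 1, since `i ≫ p` is an isomorphism; equal
    -- degrees force equality.
    refine ⟨t, hinj z _ ht'.symm ((hcl _).mp hz) ?_⟩
    have h1 := Scheme.Hom.residueDegree_comp (e.hom ≫ Spec.map δ) (Spec.map φ ≫ p) t
    rw [← Category.assoc, hδ, Scheme.Hom.residueDegree_eq_one_of_surjectiveOnStalks (i ≫ p)] at h1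
    have h2 := Nat.eq_one_of_mul_eq_one_right h1.symm
    rw [Scheme.Hom.residueDegree_comp] at h2
    rw [h.2, Nat.eq_one_of_mul_eq_one_left h2]

theorem mainTheorem12
    -- the finite base field, the smooth irreducible affine variety `X`, and its closed points
    {k : Type u} [Field k] [Finite k]
    {X : Scheme.{u}} (X_str : X ⟶ Spec (CommRingCat.of k)) [Smooth X_str]
    [IsAffine X] [IrreducibleSpace X]
    {n : ℕ} (x : Fin n → X) (hx : ∀ i, IsClosed ({x i} : Set X))
    -- the irreducible regular semi-local scheme `S'` over `U = Spec 𝒪_{X,{x₁,…,xₙ}}`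
    {S' : Scheme.{u}} [IrreducibleSpace S']
    (hS'_reg : IsRegularScheme S') (hS'_semilocal : IsSemilocalScheme S')
    (p : S' ⟶ semilocalSpec X x)
    (hS'_res : ∀ s : S', IsClosed ({s} : Set S') → Finite (S'.residueField s))
    (hS'_fib : ∀ v : semilocalSpec X x, IsClosed ({v} : Set (semilocalSpec X x)) →
      IsSemilocalScheme (p.fiber v) ∧ IsDedekindScheme (p.fiber v))
    -- the closed subscheme `T' ⊂ S'` that `p` maps isomorphically onto `U`
    {T' : Scheme.{u}} (i : T' ⟶ S') [IsClosedImmersion i] [IsIso (i ≫ p)]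
    (hdim : topologicalKrullDim T' < topologicalKrullDim S') :
    ∃ (S'' : Scheme.{u}) (ρ : S'' ⟶ S') (δ' : T' ⟶ S''),
      IrreducibleSpace S'' ∧ IsFinite ρ ∧ Etale ρ ∧ δ' ≫ ρ = i ∧
      ∀ v : semilocalSpec X x, IsClosed ({v} : Set (semilocalSpec X x)) →
        (∃! v' : T', (i ≫ p) v' = v) ∧
        (∀ v' : T', (i ≫ p) v' = v →
          ∃ z₀ : (ρ ≫ p).fiber v, (ρ ≫ p).fiberι v z₀ = δ' v' ∧
            ∀ z : (ρ ≫ p).fiber v,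
              IsRationalPoint ((ρ ≫ p).fiberToSpecResidueField v) z ↔ z = z₀) ∧
        ∀ d : ℕ, 1 ≤ d →
          numPointsOfDegree ((ρ ≫ p).fiberToSpecResidueField v) d ≤
            numPointsOfDegree
              (𝔸(PUnit.{u + 1}; Spec ((semilocalSpec X x).residueField v)) ↘
                Spec ((semilocalSpec X x).residueField v)) d := by
  have := hS'_semilocal.isAffine
  have hdomain : ∀ s : S', IsDomain (S'.presheaf.stalk s) := fun s =>
    (hS'_reg.isRegularLocalRing_stalk s).isDomain
  have : ∀ s : S', _root_.IsReduced (S'.presheaf.stalk s) := fun s => inferInstance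
  have : IsReduced S' := isReduced_of_isReduced_stalk S'
  -- Regular local rings are domains, so S' is reduced; being also irreducible, it is the spectrum
  -- of a domain.
  have : IsIntegral S' := isIntegral_of_irreducibleSpace_of_isReduced S'
  let e := S'.isoSpec
  have hcl : ∀ s : Spec Γ(S', ⊤), IsClosed ({s} : Set (Spec Γ(S', ⊤))) →
      IsClosed ({e.inv s} : Set S') := by
    intro s hs
    rw [← Set.image_singleton]
    exact e.inv.homeomorph.isClosedMap _ hs
  have hip : (i ≫ e.hom) ≫ e.inv ≫ p = i ≫ p := by simp
  have : IsIso ((i ≫ e.hom) ≫ e.inv ≫ p) := hip ▸ inferInstance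
  obtain ⟨S'', ρ, δ', hirr, hfin, het, hδ, h⟩ :=
    exists_finite_etale_of_section (e.inv ≫ p)
      (fun s => by
        have := hS'_reg.isRegularLocalRing_stalk (e.inv s)
        exact IsRegularLocalRing.of_ringEquiv (asIso (e.inv.stalkMap s)).commRingCatIsoToRingEquiv)
      ((hS'_semilocal.finite_closedPoints.preimage e.inv.homeomorph.injective.injOn).subset hcl)
      (fun s hs => by
        have := hS'_res _ (hcl s hs)
        exact Finite.of_surjective _
          ((Scheme.Hom.residueDegree_eq_one_iff _ _).mp
            (Scheme.Hom.residueDegree_eq_one_of_surjectiveOnStalks e.inv s)).2)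
      (i ≫ e.hom)
  refine ⟨S'', ρ ≫ e.inv, δ', hirr, inferInstance, inferInstance, ?_, fun v hv => ?_⟩
  · rw [← Category.assoc, hδ, Category.assoc, e.hom_inv_id, Category.comp_id]
  · have h1 := h v hv
    rw [hip] at h1
    rw [Category.assoc]
    exact h1
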